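/- Let $\mathcal P=(\mathbb R^2,N)$ be a normed plane whose unit circle $\{N=1\}$ is a smooth quadratically convex curve, parameterized by $p:\mathbb R\to\mathbb R^2$ smooth, where $\theta$ is the angle of the tangent: $p'(\theta)=\rho(\theta)(\cos\theta,\sin\theta)$ with $\rho(\theta)>0$, and $p(\theta+\pi)=-p(\theta)$. Let $\gamma:\mathbb R\to\mathbb R^2$ be a smooth front whose tangent line at $t$ has direction $\nu(t)=(\cos\varphi(t),\sin\varphi(t))$, where $\varphi:\mathbb R\to\mathbb R$ is smooth; that is, $\det(\nu(t),\gamma'(t))=0$ for all $t$ (points with $\gamma'(t)=0$ are allowed). Assume that $\gamma\in\mathcal H$, i.e. $\varphi'(t)\neq0$ for all $t$, and that $\gamma$ is closed (a hedgehog): for some $T>0$ one has $\gamma(t+T)=\gamma(t)$ for all $t$, and the tangent makes exactly one turn in a period, i.e. $\varphi(t+T)=\varphi(t)+2\pi$ for all $t$ or $\varphi(t+T)=\varphi(t)-2\pi$ for all $t$. Then there is a (unique) function $r:\mathbb R\to\mathbb R$, the $\mathcal P$-curvature radius of $\gamma$, with $\gamma'(t)=r(t)\,(p\circ\varphi)'(t)$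 for all $t$; it is smooth, and $\gamma$ has at least four $\mathcal P$-vertices, i.e. $r'(t)=0$ for at least four distinct parameters $t\in[0,T)$. (For $\gamma$ parameterized by its tangent angle, $\varphi(\theta)=\theta$ and $T=2\pi$: $\gamma'=r\,p'$, and $r'$ has at least four zeros in $[0,2\pi)$.) -/

import Mathlib

open scoped ContDiff

namespace MinkowskiPlane

noncomputable section

/-- The underlying real plane. -/
abbrev Plane := EuclideanSpace ℝ (Fin 2)

/-- The determinant `[x, y]` of a pair of vectors of the plane. -/
def bracket (x y : Plane) : ℝ := x 0 * y 1 - x 1 * y 0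

/-- The unit vector making the angle `θ` with the fixed direction `(1, 0)`. -/
def direction (θ : ℝ) : Plane := !₂[Real.cos θ, Real.sin θ]

/-- The unit circle `{x | N x = 1}` of the normed plane `(ℝ², N)` is a smooth quadratically convex
curve, and `p` is its parametrization by the angle of the tangent.
In `p' θ = ρ θ • direction θ` the number `ρ θ` is the Euclidean radius of curvature of the unit
circle at `p θ`. It is finite because `p` is smooth: this is quadratic convexity, in the form
`[p', p''] = ρ ^ 2 > 0`. It is positive because a smooth unit circle is regular. -/
structure IsUnitCircleParam (N : Seminorm ℝ Plane) (p : ℝ → Plane) : Prop where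
  smooth : ContDiff ℝ ∞ p
  range_eq : Set.range p = {x : Plane | N x = 1}
  symmetric : ∀ θ, p (θ + Real.pi) = -p θ
  tangent : ∀ θ, ∃ ρ : ℝ, 0 < ρ ∧ deriv p θ = ρ • direction θ

/-- A front in the class `ℋ`, in an arbitrary smooth parameter `t`. The smooth map
`ν : ℝ → ℝP¹` of the Legendrian immersion `(γ, ν)` is given by a smooth angle function `φ`:
`ν t` is the line spanned by `direction (φ t)`. The condition `φ' ≠ 0` is `ν' ≠ 0`; in particular
`(γ, ν)` is an immersion. -/
structure IsFrontH (γ : ℝ → Plane) (φ : ℝ → ℝ) : Prop where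
  smooth_curve : ContDiff ℝ ∞ γ
  smooth_angle : ContDiff ℝ ∞ φ
  legendrian : ∀ t, bracket (direction (φ t)) (deriv γ t) = 0
  angle_regular : ∀ t, deriv φ t ≠ 0

/-- The front closes up at the period `T`, after exactly one turn of its tangent (in either
sense). -/
structure ClosesAfterOneTurn (γ : ℝ → Plane) (φ : ℝ → ℝ) (T : ℝ) : Prop where
  period_pos : 0 < T
  periodic : ∀ t, γ (t + T) = γ t
  one_turn : (∀ t, φ (t + T) = φ t + 2 * Real.pi) ∨ (∀ t, φ (t + T) = φ t - 2 * Real.pi)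

/-- `r` is the curvature radius of the front `γ`, relative to the unit circle `p`: the derivative
of `γ` is `r` times the derivative of the unit circle, both with respect to the same parameter,
which matches points with the same tangent angle. As `(p ∘ φ)' ≠ 0` there is at most one
such `r`. For `φ = id` the condition is `γ' = r p'`. -/
def IsCurvatureRadius (p : ℝ → Plane) (γ : ℝ → Plane) (φ r : ℝ → ℝ) : Prop :=
  ∀ t, deriv γ t = r t • deriv (p ∘ φ) t

/-- The parameters in one period `[0, T)` at which the front with curvature radius `r` has a
vertex. -/
def vertices (r : ℝ → ℝ) (T : ℝ) : Set ℝ := {t | t ∈ Set.Ico 0 T ∧ deriv r t = 0}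

end

end MinkowskiPlane

namespace MinkowskiPlane

/-! Write `q = p ∘ φ`, so that `γ' = r q'`. For an affine function `ℓ = [·, v] + c` of the plane,
`(r ℓ(q) - [γ, v])' = r' ℓ(q)`, because the terms in `q'` and `γ'` cancel. Hence `r' ℓ(q)` has
integral zero over a period. With at most three zeros in a period, `r'` has a sign on each of three
arcs. Two of these signs agree, so either `r` is monotone and not constant, against periodicity, or
`r'` has opposite signs (weakly on one side) on two complementary arcs. In the latter case take for
`ℓ` the chord through the common endpoints (`IsUnitCircleParam.exists_chord`): `r' ℓ(q)` then has
one sign and is not identically zero, a contradiction (`not_two_signs`). -/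

lemma bracket_direction (s t : ℝ) : bracket (direction s) (direction t) = Real.sin (t - s) := by
  simp [bracket, direction, Real.sin_sub]
  ring

lemma bracket_smul_left (c : ℝ) (x y : Plane) : bracket (c • x) y = c * bracket x y := by
  simp [bracket]
  ring

lemma bracket_smul_right (c : ℝ) (x y : Plane) : bracket x (c • y) = c * bracket x y := by
  simp [bracket]
  ring

lemma hasDerivAt_coord {f : ℝ → Plane} {f' : Plane} {t : ℝ} (h : HasDerivAt f f' t) (i : Fin 2) :
    HasDerivAt (fun s => f s i) (f' i) t :=
  ((EuclideanSpace.proj i : Plane →L[ℝ] ℝ).hasFDerivAt.comp_hasDerivAt t h)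

lemma hasDerivAt_bracket {f : ℝ → Plane} {f' : Plane} {t : ℝ} (h : HasDerivAt f f' t)
    (v : Plane) : HasDerivAt (fun s => bracket (f s) v) (bracket f' v) t :=
  ((hasDerivAt_coord h 0).mul_const (v 1)).sub ((hasDerivAt_coord h 1).mul_const (v 0))

/-- Every vector is parallel to some direction. -/
lemma exists_bracket_direction_eq_zero (u : Plane) : ∃ α, bracket u (direction α) = 0 := by
  refine ⟨Complex.arg ⟨u 0, u 1⟩, ?_⟩
  have h1 := Complex.norm_mul_cos_arg ⟨u 0, u 1⟩
  have h2 := Complex.norm_mul_sin_arg ⟨u 0, u 1⟩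
  simp only at h1 h2
  simp only [bracket, direction]
  simp only [Matrix.cons_val_zero, Matrix.cons_val_one]
  linear_combination -Real.sin (Complex.arg ⟨u 0, u 1⟩) * h1 +
    Real.cos (Complex.arg ⟨u 0, u 1⟩) * h2

lemma direction_ne_zero (θ : ℝ) : direction θ ≠ 0 := by
  intro h
  have h0 := congrArg (fun x : Plane => x 0) h
  have h1 := congrArg (fun x : Plane => x 1) h
  simp [direction] at h0 h1
  have := Real.sin_sq_add_cos_sq θ
  rw [h0, h1] at this
  norm_num at this

lemma eq_tangentialComponent_smul_direction {θ : ℝ} {w : Plane} (h : bracket (direction θ) w = 0) :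
    w = (w 0 * Real.cos θ + w 1 * Real.sin θ) • direction θ := by
  have h' : Real.cos θ * w 1 - Real.sin θ * w 0 = 0 := by simpa [bracket, direction] using h
  have hs := Real.sin_sq_add_cos_sq θ
  ext i
  fin_cases i
  · simp [direction]
    linear_combination (-w 0) * hs - Real.sin θ * h'
  · simp [direction]
    linear_combination (-w 1) * hs + Real.cos θ * h'

lemma contDiff_tangentialComponent {f : ℝ → Plane} (hf : ContDiff ℝ ∞ f) {φ : ℝ → ℝ}
    (hφ : ContDiff ℝ ∞ φ) :
    ContDiff ℝ ∞ (fun t => deriv f t 0 * Real.cos (φ t) + deriv f t 1 * Real.sin (φ t)) := by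
  have hd : ContDiff ℝ ∞ (deriv f) := hf.deriv'
  have hc : ∀ i, ContDiff ℝ ∞ (fun t => deriv f t i) := fun i =>
    (EuclideanSpace.proj i : Plane →L[ℝ] ℝ).contDiff.comp hd
  exact ((hc 0).mul hφ.cos).add ((hc 1).mul hφ.sin)

/-! ### Chords of the unit circle -/

section UnitCircle

variable {N : Seminorm ℝ Plane} {p : ℝ → Plane}

lemma IsUnitCircleParam.add_two_pi (hp : IsUnitCircleParam N p) (θ : ℝ) :
    p (θ + 2 * Real.pi) = p θ := by
  rw [two_mul, ← add_assoc, hp.symmetric, hp.symmetric, neg_neg]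

/-- A chord separates the two arcs of the unit circle it cuts off. -/
lemma IsUnitCircleParam.exists_chord (hp : IsUnitCircleParam N p) {θ₁ θ₂ : ℝ} (h₁ : θ₁ < θ₂)
    (h₂ : θ₂ < θ₁ + 2 * Real.pi) :
    ∃ (v : Plane) (c : ℝ), (∀ θ ∈ Set.Ioo θ₁ θ₂, 0 < bracket (p θ) v + c) ∧
      ∀ θ ∈ Set.Ioo θ₂ (θ₁ + 2 * Real.pi), bracket (p θ) v + c < 0 := by
  obtain ⟨α, hα⟩ := exists_bracket_direction_eq_zero (p θ₂ - p θ₁)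
  choose ρ hρ htan using hp.tangent
  have hder (v : Plane) (c θ : ℝ) :
      HasDerivAt (fun s => bracket (p s) v + c) (ρ θ * bracket (direction θ) v) θ := by
    have h := (hp.smooth.differentiable (by simp) θ).hasDerivAt
    rw [htan] at h
    rw [← bracket_smul_left]
    exact (hasDerivAt_bracket h v).add_const c
  have h12 : bracket (p θ₂) (direction α) = bracket (p θ₁) (direction α) := by
    simp only [bracket, PiLp.sub_apply] at hα ⊢
    linarith
  have hcont (v : Plane) (c : ℝ) : Continuous (fun s => bracket (p s) v + c) :=
    continuous_iff_continuousAt.2 fun θ => (hder v c θ).continuousAt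
  have hsin {a b : ℝ} (hab : a < b)
      (h : bracket (p a) (direction α) = bracket (p b) (direction α)) :
      ∃ x ∈ Set.Ioo a b, Real.sin (α - x) = 0 := by
    obtain ⟨x, hx, h0⟩ := exists_hasDerivAt_eq_zero hab (hcont (direction α) 0).continuousOn
      (by simpa using h) (fun x _ => hder (direction α) 0 x)
    rw [bracket_direction] at h0
    exact ⟨x, hx, (mul_eq_zero.1 h0).resolve_left (hρ x).ne'⟩
  -- By Rolle, each of the two arcs has a tangent parallel to the chord; these tangent angles differ
  -- by `π`.
  obtain ⟨c₁, hc₁, hs₁⟩ := hsin h₁ h12.symm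
  obtain ⟨c₂, hc₂, hs₂⟩ := hsin h₂ (by rw [h12, hp.add_two_pi])
  have hcc : c₂ = c₁ + Real.pi := by
    have h0 : Real.sin (c₂ - c₁ - Real.pi) = 0 := by
      rw [Real.sin_sub_pi, show c₂ - c₁ = (α - c₁) - (α - c₂) by ring, Real.sin_sub, hs₁, hs₂]
      simp
    have := (Real.sin_eq_zero_iff_of_lt_of_lt (by linarith [hc₁.2, hc₂.1])
      (by linarith [hc₁.1, hc₂.2])).1 h0
    linarith
  -- `k = ±1` orients the chord so that the affine function increases on leaving `θ₁`.
  set k := Real.cos (α - c₁) with hk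
  have hk2 : k * k = 1 := by
    have := Real.sin_sq_add_cos_sq (α - c₁)
    rw [hs₁] at this
    linarith
  set v : Plane := k • direction α with hv
  set c : ℝ := -bracket (p θ₁) v with hc
  have hder' (θ : ℝ) : deriv (fun s => bracket (p s) v + c) θ = - (ρ θ * Real.sin (θ - c₁)) := by
    rw [(hder v c θ).deriv, hv, bracket_smul_right, bracket_direction,
      show α - θ = (α - c₁) - (θ - c₁) by ring, Real.sin_sub, hs₁, ← hk]
    linear_combination (-ρ θ * Real.sin (θ - c₁)) * hk2
  have e₁ : bracket (p θ₁) v + c = 0 := by simp [hc]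
  have e₂ : bracket (p θ₂) v + c = 0 := by
    rw [hc, hv, bracket_smul_right, bracket_smul_right, h12]
    ring
  have e₃ : bracket (p (θ₁ + 2 * Real.pi)) v + c = 0 := by rw [hp.add_two_pi, e₁]
  have m₁ : StrictMonoOn (fun s => bracket (p s) v + c) (Set.Icc θ₁ c₁) := by
    refine strictMonoOn_of_deriv_pos (convex_Icc _ _) (hcont v c).continuousOn fun x hx => ?_
    rw [interior_Icc] at hx
    rw [hder', neg_pos]
    exact mul_neg_of_pos_of_neg (hρ x) (Real.sin_neg_of_neg_of_neg_pi_lt (by linarith [hx.2])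
      (by linarith [hx.1, hc₂.2]))
  have m₂ : StrictAntiOn (fun s => bracket (p s) v + c) (Set.Icc c₁ c₂) := by
    refine strictAntiOn_of_deriv_neg (convex_Icc _ _) (hcont v c).continuousOn fun x hx => ?_
    rw [interior_Icc] at hx
    rw [hder', neg_lt_zero]
    exact mul_pos (hρ x) (Real.sin_pos_of_pos_of_lt_pi (by linarith [hx.1]) (by linarith [hx.2]))
  have m₃ : StrictMonoOn (fun s => bracket (p s) v + c) (Set.Icc c₂ (θ₁ + 2 * Real.pi)) := by
    refine strictMonoOn_of_deriv_pos (convex_Icc _ _) (hcont v c).continuousOn fun x hx => ?_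
    rw [interior_Icc] at hx
    rw [hder', neg_pos, ← Real.sin_sub_two_pi]
    exact mul_neg_of_pos_of_neg (hρ x) (Real.sin_neg_of_neg_of_neg_pi_lt
      (by linarith [hx.2, hc₁.1]) (by linarith [hx.1]))
  obtain ⟨a₁, b₁⟩ := hc₁
  obtain ⟨a₂, b₂⟩ := hc₂
  refine ⟨v, c, fun θ hθ => ?_, fun θ hθ => ?_⟩
  · rcases le_total θ c₁ with h | h
    · rw [← e₁]
      exact m₁ ⟨le_rfl, a₁.le⟩ ⟨hθ.1.le, h⟩ hθ.1
    · rw [← e₂]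
      exact m₂ ⟨h, (hθ.2.trans a₂).le⟩ ⟨b₁.le, a₂.le⟩ hθ.2
  · rcases le_total θ c₂ with h | h
    · rw [← e₂]
      exact m₂ ⟨b₁.le, a₂.le⟩ ⟨(b₁.trans hθ.1).le, h⟩ hθ.1
    · rw [← e₃]
      exact m₃ ⟨h, hθ.2.le⟩ ⟨b₂.le, le_rfl⟩ hθ.2

end UnitCircle

/-! ### Sign patterns of the derivative of the curvature radius -/

/-- A closed curve of period `T` for which any two points of a period are separated by a chord. -/
def IsChordSeparated (q : ℝ → Plane) (T : ℝ) : Prop :=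
  ∀ a b, a < b → b < a + T → ∃ (v : Plane) (c : ℝ),
    (∀ t ∈ Set.Ioo a b, 0 < bracket (q t) v + c) ∧
      ∀ t ∈ Set.Ioo b (a + T), bracket (q t) v + c < 0

/-- A continuous function without zeros has constant sign. -/
lemma exists_sign_of_ne_zero {g : ℝ → ℝ} (hg : Continuous g) {s : Set ℝ} (hs : IsPreconnected s)
    (h : ∀ t ∈ s, g t ≠ 0) : ∃ ε : ℝ, (ε = 1 ∨ ε = -1) ∧ ∀ t ∈ s, 0 < ε * g t := by
  by_cases hpos : ∀ t ∈ s, 0 < g t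
  · exact ⟨1, .inl rfl, by simpa using hpos⟩
  · push Not at hpos
    obtain ⟨x, hx, hx0⟩ := hpos
    refine ⟨-1, .inr rfl, fun t ht => ?_⟩
    by_contra hcon
    have hc : 0 ≤ g t := by linarith
    obtain ⟨z, hz, hz0⟩ := hs.intermediate_value hx ht hg.continuousOn ⟨hx0, hc⟩
    exact h z hz hz0

lemma IsFrontH.strictMono_or_strictAnti {γ : ℝ → Plane} {φ : ℝ → ℝ} (h : IsFrontH γ φ) :
    StrictMono φ ∨ StrictAnti φ := by
  obtain ⟨ε, hε, hs⟩ := exists_sign_of_ne_zero (h.smooth_angle.continuous_deriv (by simp))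
    isPreconnected_univ (fun t _ => h.angle_regular t)
  rcases hε with rfl | rfl
  · exact .inl (strictMono_of_deriv_pos fun t => by simpa using hs t trivial)
  · exact .inr (strictAnti_of_deriv_neg fun t => by simpa using hs t trivial)

lemma isChordSeparated_comp {N : Seminorm ℝ Plane} {p γ : ℝ → Plane} {φ : ℝ → ℝ} {T : ℝ}
    (hp : IsUnitCircleParam N p) (hγ : IsFrontH γ φ) (hT : ClosesAfterOneTurn γ φ T) :
    IsChordSeparated (p ∘ φ) T := by
  intro a b hab hbT
  have hpi := Real.pi_pos
  rcases hγ.strictMono_or_strictAnti with hm | hm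
  · have hφ : φ (a + T) = φ a + 2 * Real.pi := by
      refine hT.one_turn.elim (fun h => h a) fun h => ?_
      have := hm (lt_add_of_pos_right a hT.period_pos)
      linarith [h a]
    obtain ⟨v, c, h₁, h₂⟩ := hp.exists_chord (hm hab) (hφ ▸ hm hbT)
    exact ⟨v, c, fun t ht => h₁ _ ⟨hm ht.1, hm ht.2⟩,
      fun t ht => h₂ _ ⟨hm ht.1, hφ ▸ hm ht.2⟩⟩
  · have hφ : φ (a + T) + 2 * Real.pi = φ a := by
      refine hT.one_turn.elim (fun h => ?_) fun h => by linarith [h a]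
      have := hm (lt_add_of_pos_right a hT.period_pos)
      linarith [h a]
    -- A decreasing angle exchanges the two arcs, so the chord function changes sign.
    obtain ⟨v, c, h₁, h₂⟩ := hp.exists_chord (hm hbT) (hφ.symm ▸ hm hab)
    have hneg (t : ℝ) : bracket ((p ∘ φ) t) (-v) + -c = -(bracket (p (φ t)) v + c) := by
      simp [bracket]
      ring
    refine ⟨-v, -c, fun t ht => ?_, fun t ht => ?_⟩
    · rw [hneg, neg_pos]
      exact h₂ _ ⟨hm ht.2, hφ.symm ▸ hm ht.1⟩
    · rw [hneg, neg_lt_zero]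
      exact h₁ _ ⟨hm ht.2, hm ht.1⟩

lemma lt_of_deriv_nonneg_of_pos {F F' : ℝ → ℝ} (hF : ∀ t, HasDerivAt F (F' t) t) {a b c : ℝ}
    (hab : a < b) (hbc : b ≤ c) (h₁ : ∀ t ∈ Set.Ioo a b, 0 < F' t)
    (h₂ : ∀ t ∈ Set.Ioo b c, 0 ≤ F' t) : F a < F c := by
  have hcont : Continuous F := continuous_iff_continuousAt.2 fun t => (hF t).continuousAt
  have m₁ : StrictMonoOn F (Set.Icc a b) := by
    refine strictMonoOn_of_deriv_pos (convex_Icc _ _) hcont.continuousOn fun x hx => ?_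
    rw [interior_Icc] at hx
    rw [(hF x).deriv]
    exact h₁ x hx
  have m₂ : MonotoneOn F (Set.Icc b c) := by
    refine monotoneOn_of_deriv_nonneg (convex_Icc _ _) hcont.continuousOn
      (fun x _ => (hF x).differentiableAt.differentiableWithinAt) fun x hx => ?_
    rw [interior_Icc] at hx
    rw [(hF x).deriv]
    exact h₂ x hx
  exact (m₁ ⟨le_rfl, hab.le⟩ ⟨hab.le, le_rfl⟩ hab).trans_le
    (m₂ ⟨le_rfl, hbc⟩ ⟨hbc, le_rfl⟩ hbc)

/-- The derivative of the curvature radius of a closed front cannot have one sign on an arc and the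
opposite sign on the complementary arc. -/
lemma not_two_signs {q γ : ℝ → Plane} {r : ℝ → ℝ} {T : ℝ} (hq : IsChordSeparated q T)
    (hqd : Differentiable ℝ q) (hγd : Differentiable ℝ γ) (hrd : Differentiable ℝ r)
    (hqT : ∀ t, q (t + T) = q t) (hγT : ∀ t, γ (t + T) = γ t) (hrT : ∀ t, r (t + T) = r t)
    (hr : ∀ t, deriv γ t = r t • deriv q t) {a b ε : ℝ} (hab : a < b) (hbT : b < a + T)
    (h₁ : ∀ t ∈ Set.Ioo a b, 0 < ε * deriv r t)
    (h₂ : ∀ t ∈ Set.Ioo b (a + T), ε * deriv r t ≤ 0) : False := by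
  obtain ⟨v, c, hv₁, hv₂⟩ := hq a b hab hbT
  -- The relation `γ' = r q'` leaves only the term with `r'`.
  have hF (t : ℝ) : HasDerivAt
      (fun s => ε * (r s * (bracket (q s) v + c) - bracket (γ s) v))
      (ε * deriv r t * (bracket (q t) v + c)) t := by
    have h := (((hrd t).hasDerivAt.mul ((hasDerivAt_bracket (hqd t).hasDerivAt v).add_const c)).sub
      (hasDerivAt_bracket (hγd t).hasDerivAt v)).const_mul ε
    rw [hr, bracket_smul_left] at h
    exact h.congr_deriv (by ring)
  have := lt_of_deriv_nonneg_of_pos hF hab hbT.le (fun t ht => mul_pos (h₁ t ht) (hv₁ t ht))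
    (fun t ht => mul_nonneg_of_nonpos_of_nonpos (h₂ t ht) (hv₂ t ht).le)
  simp [hqT, hγT, hrT] at this

/-- Padding to exactly three points avoids a case split on the number of zeros; superfluous points
do no harm, since only the absence of zeros elsewhere is used. -/
lemma exists_three_of_encard_lt_four {T : ℝ} (hT : 0 < T) {Z : Set ℝ} (hZ : Z ⊆ Set.Ico 0 T)
    (h : Z.encard < 4) : ∃ x y z : ℝ, 0 ≤ x ∧ x < y ∧ y < z ∧ z < T ∧ Z ⊆ {x, y, z} := by
  have h3 : Z.encard ≤ 3 := by
    rw [show (4 : ℕ∞) = 3 + 1 by norm_num] at h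
    exact Order.le_of_lt_add_one h
  obtain ⟨W, hZW, hWI, hW⟩ := Set.exists_superset_subset_encard_eq hZ h3
    (by rw [(Set.Ico_infinite hT).encard_eq]; exact le_top)
  have hfin : W.Finite := Set.finite_of_encard_eq_coe (k := 3) hW
  have hcard : hfin.toFinset.card = 3 := by
    have := hfin.encard_eq_coe_toFinset_card
    rw [hW] at this
    exact_mod_cast this.symm
  set e := hfin.toFinset.orderEmbOfFin hcard with he
  have hmem (i : Fin 3) : e i ∈ Set.Ico 0 T :=
    hWI (hfin.mem_toFinset.1 (Finset.orderEmbOfFin_mem _ hcard i))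
  refine ⟨e 0, e 1, e 2, (hmem 0).1, e.strictMono (by decide), e.strictMono (by decide),
    (hmem 2).2, fun t ht => ?_⟩
  have : t ∈ Set.range e := by
    rw [he, Finset.range_orderEmbOfFin]
    simpa using hZW ht
  obtain ⟨i, rfl⟩ := this
  fin_cases i <;> simp

lemma four_le_encard_vertices {q γ : ℝ → Plane} {r : ℝ → ℝ} {T : ℝ} (hT : 0 < T)
    (hq : IsChordSeparated q T)
    (hqd : Differentiable ℝ q) (hγd : Differentiable ℝ γ) (hrd : ContDiff ℝ ∞ r)
    (hqT : ∀ t, q (t + T) = q t) (hγT : ∀ t, γ (t + T) = γ t) (hrT : ∀ t, r (t + T) = r t)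
    (hr : ∀ t, deriv γ t = r t • deriv q t) : 4 ≤ (vertices r T).encard := by
  by_contra! hlt
  obtain ⟨x, y, z, h0x, hxy, hyz, hzT, hZ⟩ :=
    exists_three_of_encard_lt_four hT (fun t ht => ht.1) hlt
  have hrd' : Differentiable ℝ r := hrd.differentiable (by simp)
  have hgT (t : ℝ) : deriv r (t + T) = deriv r t := by
    rw [← deriv_comp_add_const, funext hrT]
  have hne (t : ℝ) (ht : t ∈ Set.Ico 0 T) (hx : t ≠ x) (hy : t ≠ y) (hz : t ≠ z) :
      deriv r t ≠ 0 := fun h => by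
    rcases hZ ⟨ht, h⟩ with h | h | h <;> contradiction
  have hg : Continuous (deriv r) := hrd.continuous_deriv (by simp)
  have hsign {a b : ℝ} (h : ∀ t ∈ Set.Ioo a b, deriv r t ≠ 0) :
      ∃ ε : ℝ, (ε = 1 ∨ ε = -1) ∧ (∀ t ∈ Set.Ioo a b, 0 < ε * deriv r t) :=
    exists_sign_of_ne_zero hg isPreconnected_Ioo h
  obtain ⟨ε₁, hε₁, s₁⟩ := hsign (a := x) (b := y) fun t ht =>
    hne t ⟨by linarith [ht.1], by linarith [ht.2]⟩ ht.1.ne' ht.2.ne (ht.2.trans hyz).ne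
  obtain ⟨ε₂, hε₂, s₂⟩ := hsign (a := y) (b := z) fun t ht =>
    hne t ⟨by linarith [ht.1], by linarith [ht.2]⟩ (hxy.trans ht.1).ne' ht.1.ne' ht.2.ne
  obtain ⟨ε₃, hε₃, s₃⟩ := hsign (a := z) (b := x + T) fun t ht => by
    rcases lt_or_ge t T with h | h
    · exact hne t ⟨by linarith [ht.1], h⟩ ((hxy.trans hyz).trans ht.1).ne' (hyz.trans ht.1).ne'
        ht.1.ne'
    · have hlt : t - T < x := by linarith [ht.2]
      rw [← sub_add_cancel t T, hgT]
      exact hne _ ⟨by linarith, by linarith⟩ hlt.ne (hlt.trans hxy).ne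
        (hlt.trans (hxy.trans hyz)).ne
  have shift {a b ε : ℝ} (h : ∀ t ∈ Set.Ioo a b, 0 < ε * deriv r t) :
      ∀ t ∈ Set.Ioo (a + T) (b + T), 0 < ε * deriv r t := fun t ht => by
    rw [← sub_add_cancel t T, hgT]
    exact h _ ⟨by linarith [ht.1], by linarith [ht.2]⟩
  -- The inequality is only weak because `r'` may vanish at `b` without changing sign.
  have join {a b c ε : ℝ} (hab : a < b) (hbc : b < c) (h₁ : ∀ t ∈ Set.Ioo a b, 0 < ε * deriv r t)
      (h₂ : ∀ t ∈ Set.Ioo b c, 0 < ε * deriv r t) : ∀ t ∈ Set.Ioo a c, 0 ≤ ε * deriv r t := by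
    have hcl : IsClosed {t | 0 ≤ ε * deriv r t} := isClosed_le continuous_const (hg.const_mul ε)
    have cl {a b : ℝ} (hab : a < b) (h : ∀ t ∈ Set.Ioo a b, 0 < ε * deriv r t) :
        Set.Icc a b ⊆ {t | 0 ≤ ε * deriv r t} := by
      rw [← closure_Ioo hab.ne]
      exact hcl.closure_subset_iff.2 fun t ht => (h t ht).le
    intro t ht
    rcases le_total t b with h | h
    · exact cl hab h₁ ⟨ht.1.le, h⟩
    · exact cl hbc h₂ ⟨h, ht.2.le⟩
  have key {a b c ε δ : ℝ} (hab : a < b) (hbc : b < c) (hca : c < a + T)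
      (h₁ : ∀ t ∈ Set.Ioo a b, 0 < ε * deriv r t) (h₂ : ∀ t ∈ Set.Ioo b c, 0 < δ * deriv r t)
      (h₃ : ∀ t ∈ Set.Ioo c (a + T), 0 < δ * deriv r t) (hδ : ε = -δ) : False := by
    refine not_two_signs hq hqd hγd hrd' hqT hγT hrT hr hab (hbc.trans hca) h₁ fun t ht => ?_
    have := join hbc hca h₂ h₃ t ht
    rw [hδ]
    linarith
  have hxT : z < x + T := by linarith
  have hyT : x + T < y + T := by linarith
  have hzT' : y + T < z + T := by linarith
  -- Unless all three signs agree, exactly one arc differs from the other two, which are cyclically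
  -- adjacent.
  by_cases h12 : ε₁ = ε₂
  · by_cases h23 : ε₂ = ε₃
    · subst h12 h23
      have := lt_of_deriv_nonneg_of_pos (fun t => (hrd' t).hasDerivAt.const_mul ε₁) hxy
        (hyz.trans hxT).le s₁ (join hyz hxT s₂ s₃)
      rw [hrT] at this
      exact lt_irrefl _ this
    · subst h12
      exact key hxT hyT hzT' s₃ (shift s₁) (shift s₂) (by grind)
  · by_cases h23 : ε₂ = ε₃
    · subst h23
      exact key hxy hyz hxT s₁ s₂ s₃ (by grind)
    · have h13 : ε₁ = ε₃ := by grind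
      subst h13
      exact key hyz hxT hyT s₂ s₃ (shift s₁) (by grind)

end MinkowskiPlane

open MinkowskiPlane in
theorem mainTheorem8
    (N : Seminorm ℝ MinkowskiPlane.Plane) (hN : ∀ x, N x = 0 → x = 0)
    (p : ℝ → MinkowskiPlane.Plane) (hp : MinkowskiPlane.IsUnitCircleParam N p)
    (γ : ℝ → MinkowskiPlane.Plane) (φ : ℝ → ℝ) (hγ : MinkowskiPlane.IsFrontH γ φ)
    (T : ℝ) (hT : MinkowskiPlane.ClosesAfterOneTurn γ φ T) :
    ∃ r : ℝ → ℝ, MinkowskiPlane.IsCurvatureRadius p γ φ r ∧ ContDiff ℝ ∞ r ∧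
      4 ≤ (MinkowskiPlane.vertices r T).encard := by
  choose ρ hρ htan using hp.tangent
  have hρeq : ρ = fun θ => deriv p θ 0 * Real.cos θ + deriv p θ 1 * Real.sin θ := by
    funext θ
    rw [htan]
    simp [direction]
    linear_combination (-ρ θ) * Real.sin_sq_add_cos_sq θ
  have hρs : ContDiff ℝ ∞ ρ := hρeq ▸ contDiff_tangentialComponent hp.smooth contDiff_id
  have hq (t : ℝ) : deriv (p ∘ φ) t = (deriv φ t * ρ (φ t)) • direction (φ t) := by
    rw [deriv.scomp t (hp.smooth.differentiable (by simp) _)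
      (hγ.smooth_angle.differentiable (by simp) _), htan, smul_smul]
  have hne (t : ℝ) : deriv φ t * ρ (φ t) ≠ 0 := mul_ne_zero (hγ.angle_regular t) (hρ _).ne'
  have hqT (t : ℝ) : (p ∘ φ) (t + T) = (p ∘ φ) t := by
    rcases hT.one_turn with h | h
    · simp only [Function.comp_apply, h, hp.add_two_pi]
    · rw [Function.comp_apply, h, ← hp.add_two_pi, sub_add_cancel, Function.comp_apply]
  -- `r` is the quotient of the signed speeds of `γ` and `p ∘ φ` along `direction (φ t)`; it
  -- vanishes where `γ' = 0`.
  set f : ℝ → ℝ := fun t => deriv γ t 0 * Real.cos (φ t) + deriv γ t 1 * Real.sin (φ t) with hf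
  set r : ℝ → ℝ := fun t => f t / (deriv φ t * ρ (φ t)) with hr
  have hcr : IsCurvatureRadius p γ φ r := fun t => by
    rw [hq, smul_smul, hr, div_mul_cancel₀ _ (hne t)]
    exact eq_tangentialComponent_smul_direction (hγ.legendrian t)
  have hrs : ContDiff ℝ ∞ r :=
    (contDiff_tangentialComponent hγ.smooth_curve hγ.smooth_angle).div
      (hγ.smooth_angle.deriv'.mul (hρs.comp hγ.smooth_angle)) hne
  have hrT (t : ℝ) : r (t + T) = r t := by
    have h₁ : deriv γ (t + T) = deriv γ t := by
      rw [← deriv_comp_add_const, funext hT.periodic]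
    have h₂ : deriv (p ∘ φ) (t + T) = deriv (p ∘ φ) t := by
      rw [← deriv_comp_add_const, funext hqT]
    have h₃ := hcr (t + T)
    rw [h₁, h₂, hcr t] at h₃
    refine (smul_left_injective ℝ ?_ h₃).symm
    rw [hq]
    exact smul_ne_zero (hne t) (direction_ne_zero _)
  exact ⟨r, hcr, hrs, four_le_encard_vertices hT.period_pos (isChordSeparated_comp hp hγ hT)
    ((hp.smooth.comp hγ.smooth_angle).differentiable (by simp))
    (hγ.smooth_curve.differentiable (by simp)) hrs hqT hT.periodic hrT hcr⟩
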